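/- Let $M\ge 4$ and $h\ge 4$ and let $T=(V,E)$ be a perfect $M$-ary tree of height $h$ with root $r$ and $n=|V|$ nodes: a finite rooted tree in which every non-leaf node has exactly $M$ children and all leaves are at distance $h$ from $r$. All edges have weight $1$, $L$ is the graph Laplacian of $T$, and $d_{uv}$ is the graph distance. For a nonempty set $S\subseteq V$ of noise-free leaders (held at $0$), the followers $V\setminus S$ have the dynamics $\dot{\mathbf x}_f=-L_{ff}\mathbf x_f+\mathbf d_f$, where $L_{ff}$ is the principal submatrix of $L$ indexed by $V\setminus S$ and $\mathbf d_f$ is a vector of independent unit-variance white noises. The coherence of $S$ is $$R_{NF}(S)=\lim_{t\to\infty}\sum_{i\in V\setminus S}\mathbb E[x_i(t)^2]=\tfrac12\operatorname{tr}\bigl(L_{ff}^{-1}\bigr),$$ where the limit exists and has this value for every deterministic initial follower state. Then a nonempty set $S\subseteq V$ with $|S|\le 2$ minimizes $R_{NF}$ among all such sets if and only if $S=\{x,y\}$ for some nodes $x,y$ with $d_{xy}=1$ and $d_{xr}=0$, i.e. $S$ consists of the root and one of its children. The resulting minimal coherence is $$R_{NF}(S)=\frac12\Bigl(n+\frac1{M-1}\Bigr)\log_M(nM-n+1)-\frac{n(M^2+M-1)}{2M(M-1)}+\frac1{2M}.$$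 -/

import Mathlib

open Filter Topology MeasureTheory ProbabilityTheory
open scoped Matrix

noncomputable section

namespace LeaderFollower

variable {V : Type*} [Fintype V] [DecidableEq V]

/-- The children of `v` in a tree `T` rooted at `r`: the neighbours of `v` one level below `v`,
where the level of a node is its graph distance from the root. -/
def children (T : SimpleGraph V) [DecidableRel T.Adj] (r v : V) : Finset V :=
  Finset.univ.filter fun w => T.Adj v w ∧ T.dist w r = T.dist v r + 1

/-- `T` with root `r` is a perfect `M`-ary tree of height `h`: it is a tree in which every
node has either no children (a leaf) or exactly `M` children, and all leaves have level `h`. -/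
structure IsPerfectMAryTree (T : SimpleGraph V) [DecidableRel T.Adj] (r : V) (M h : ℕ) :
    Prop where
  isTree : T.IsTree
  card_children : ∀ v, children T r v ≠ ∅ → (children T r v).card = M
  level_leaf : ∀ v, children T r v = ∅ → T.dist v r = h

/-- The follower block `L_ff` of the Laplacian (all edge weights equal to one) for the
leader set `S`. -/
def followerLaplacian (G : SimpleGraph V) [DecidableRel G.Adj] (S : Finset V) :
    Matrix {v // v ∉ S} {v // v ∉ S} ℝ :=
  (G.lapMatrix ℝ).submatrix Subtype.val Subtype.val

/-- The law at time `t` of the follower state under the noisy consensus dynamics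
`dx = - L_ff x dt + dW`, `x(0) = x₀`, with noise-free leaders held at the external signal `0`
and `W` a standard Brownian motion (one independent coordinate for each follower):
the Gaussian law with mean `exp(- t L_ff) x₀` and covariance
`∫₀ᵗ exp(- s L_ff) exp(- s L_ff)ᵀ ds`. -/
def followerLaw (G : SimpleGraph V) [DecidableRel G.Adj] (S : Finset V)
    (x₀ : {v // v ∉ S} → ℝ) (t : ℝ) : Measure (EuclideanSpace ℝ {v // v ∉ S}) :=
  multivariateGaussian
    (WithLp.toLp 2 (NormedSpace.exp (-(t • followerLaplacian G S)) *ᵥ x₀))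
    (Matrix.of fun i j => ∫ s in (0 : ℝ)..t,
      (NormedSpace.exp (-(s • followerLaplacian G S)) *
        (NormedSpace.exp (-(s • followerLaplacian G S)))ᵀ) i j)

/-- The total variance `∑_{i ∉ S} 𝔼[x_i(t)²]` of the followers at time `t`. -/
def totalVariance (G : SimpleGraph V) [DecidableRel G.Adj] (S : Finset V)
    (x₀ : {v // v ∉ S} → ℝ) (t : ℝ) : ℝ :=
  ∑ i, ∫ x, (x i) ^ 2 ∂(followerLaw G S x₀ t)

/-- The coherence `R_NF(S) = (1/2) tr (L_ff⁻¹)` for a set `S` of noise-free leaders. -/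
def coherence (G : SimpleGraph V) [DecidableRel G.Adj] (S : Finset V) : ℝ :=
  (1 / 2) * (followerLaplacian G S)⁻¹.trace

/-- `S` solves the noise-free `k`-leader selection problem: it minimizes the coherence among
all nonempty sets of at most `k` nodes. (Without leaders there is no steady state, and
`L_ff` is singular.) -/
def IsOptimalLeaderSet (G : SimpleGraph V) [DecidableRel G.Adj] (k : ℕ) (S : Finset V) : Prop :=
  (S.Nonempty ∧ S.card ≤ k) ∧
    ∀ S' : Finset V, S'.Nonempty → S'.card ≤ k → coherence G S ≤ coherence G S'

end LeaderFollower

end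

/-! The steady state is spectral. A leader in a connected graph makes `L_ff` positive definite, so
in an eigenbasis the mean decays and the covariance tends to half of `L_ff⁻¹`.

On a tree that inverse is explicit. The Laplacian of `d(·, x)` at `u` is `2 - deg u`, less 2 at `u =
x`, so `(d(u,x) + d(v,x) - d(u,v)) / 2` inverts the Laplacian grounded at `x`. A rank-one correction
grounds it at `y` too, and the trace becomes a combination of `∑ d(u,x)`, `∑ d(u,y)` and `∑ (d(u,x)
- d(u,y))²` (`trace_inv_pair`).

Crossing the edge above `z` changes each distance by one, with sign decided by membership in the
subtree of `z`, whose size `s k` depends only on the level `k`. Hence the coherence of a pair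
depends only on the level `e` of the deepest common ancestor and the arm lengths `a`, `b`
(`coherence_pair`).

What remains is an inequality for sequences with `4 s (k+1) ≤ s k` (`pairExcess_gt`): the excess per
unit of distance is above `-s 1`, except for a root-child pair, which attains it. The critical rival
is a pair of children of the root; it loses exactly when `4 s 1 < s 0`, which follows from `s 0 = M
s 1 + 1` and `M ≥ 4`. -/

namespace LeaderFollower

/-! ### Second moments of the linear dynamics in an eigenbasis. -/

section Dynamics

variable {ι : Type*} [Fintype ι] [DecidableEq ι]

/-- A function of a real symmetric matrix, written in an orthonormal eigenbasis. -/
noncomputable def eigenFun {A : Matrix ι ι ℝ} (hA : A.IsHermitian) (f : ℝ → ℝ) : Matrix ι ι ℝ :=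
  (hA.eigenvectorUnitary : Matrix ι ι ℝ) * Matrix.diagonal (fun k => f (hA.eigenvalues k)) *
    star (hA.eigenvectorUnitary : Matrix ι ι ℝ)

variable {A : Matrix ι ι ℝ} (hA : A.IsHermitian)

lemma eigenFun_id : eigenFun hA (fun l => l) = A := by
  conv_rhs => rw [hA.spectral_theorem]
  rfl

lemma eigenFun_one : eigenFun hA (fun _ => 1) = 1 := by
  simp [eigenFun]

lemma eigenFun_mul (f g : ℝ → ℝ) :
    eigenFun hA f * eigenFun hA g = eigenFun hA (fun l => f l * g l) := by
  have hU : star (hA.eigenvectorUnitary : Matrix ι ι ℝ) * hA.eigenvectorUnitary = 1 := by simp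
  rw [eigenFun, eigenFun, eigenFun, ← Matrix.diagonal_mul_diagonal]
  simp only [Matrix.mul_assoc]
  rw [← Matrix.mul_assoc (star _) (hA.eigenvectorUnitary : Matrix ι ι ℝ), hU, Matrix.one_mul]

lemma eigenFun_transpose (f : ℝ → ℝ) : (eigenFun hA f)ᵀ = eigenFun hA f := by
  simp only [eigenFun, Matrix.star_eq_conjTranspose, Matrix.conjTranspose_eq_transpose_of_trivial,
    Matrix.transpose_mul, Matrix.transpose_transpose, Matrix.diagonal_transpose, Matrix.mul_assoc]

lemma eigenFun_apply (f : ℝ → ℝ) (i j : ι) :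
    eigenFun hA f i j = ∑ k, (hA.eigenvectorUnitary : Matrix ι ι ℝ) i k *
      f (hA.eigenvalues k) * (hA.eigenvectorUnitary : Matrix ι ι ℝ) j k := by
  simp [eigenFun, Matrix.mul_apply, Matrix.diagonal_apply, Matrix.star_apply]

lemma eigenFun_trace (f : ℝ → ℝ) :
    (eigenFun hA f).trace = ∑ k, f (hA.eigenvalues k) := by
  rw [eigenFun, Matrix.trace_mul_comm, ← Matrix.mul_assoc]
  simp [Matrix.trace_diagonal]

lemma eigenFun_posSemidef {f : ℝ → ℝ} (hf : ∀ k, 0 ≤ f (hA.eigenvalues k)) :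
    (eigenFun hA f).PosSemidef := by
  rw [eigenFun, Matrix.star_eq_conjTranspose]
  exact (Matrix.PosSemidef.diagonal hf).mul_mul_conjTranspose_same _

lemma exp_neg_smul_eq_eigenFun (s : ℝ) :
    NormedSpace.exp (-(s • A)) = eigenFun hA (fun l => Real.exp (-(s * l))) := by
  have hu : IsUnit (hA.eigenvectorUnitary : Matrix ι ι ℝ) :=
    IsUnit.of_mul_eq_one (star (hA.eigenvectorUnitary : Matrix ι ι ℝ)) (by simp)
  have hinv : star (hA.eigenvectorUnitary : Matrix ι ι ℝ) =
      (hA.eigenvectorUnitary : Matrix ι ι ℝ)⁻¹ := by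
    exact (Matrix.inv_eq_left_inv (by simp)).symm
  have h1 : -(s • A) = (hA.eigenvectorUnitary : Matrix ι ι ℝ) *
      Matrix.diagonal (fun k => -(s * hA.eigenvalues k)) *
      (hA.eigenvectorUnitary : Matrix ι ι ℝ)⁻¹ := by
    conv_lhs => rw [← eigenFun_id hA, eigenFun]
    rw [← hinv, ← neg_smul, ← Matrix.smul_mul, ← Matrix.mul_smul, ← Matrix.diagonal_smul]
    congr 3
    ext k; simp
  rw [h1, Matrix.exp_conj _ _ hu, Matrix.exp_diagonal, eigenFun, ← hinv]
  congr 3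
  ext k
  rw [Pi.coe_exp, ← Real.exp_eq_exp_ℝ]

/-- `∫₀ᵗ exp(-s A) exp(-s A)ᵀ ds` in an eigenbasis of `A`. -/
lemma integral_exp_mul_transpose (hA : A.PosDef) (t : ℝ) :
    (Matrix.of fun i j => ∫ s in (0 : ℝ)..t,
      (NormedSpace.exp (-(s • A)) * (NormedSpace.exp (-(s • A)))ᵀ) i j) =
    eigenFun hA.isHermitian (fun l => (1 - Real.exp (-(2 * t * l))) / (2 * l)) := by
  ext i j
  simp only [Matrix.of_apply, exp_neg_smul_eq_eigenFun hA.isHermitian, eigenFun_transpose,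
    eigenFun_mul, eigenFun_apply]
  rw [intervalIntegral.integral_finsetSum]
  · refine Finset.sum_congr rfl fun k _ => ?_
    rw [intervalIntegral.integral_mul_const, intervalIntegral.integral_const_mul]
    congr 2
    have hl := hA.eigenvalues_pos k
    set l := hA.isHermitian.eigenvalues k
    have hd : ∀ s ∈ Set.uIcc 0 t, HasDerivAt (fun s => -Real.exp (-(2 * s * l)) / (2 * l))
        (Real.exp (-(s * l)) * Real.exp (-(s * l))) s := by
      intro s _
      have h0 : HasDerivAt (fun s : ℝ => -(2 * s * l)) (-(2 * l)) s := by
        simpa using (((hasDerivAt_id' s).const_mul 2).mul_const l).fun_neg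
      refine (h0.exp.fun_neg.div_const (2 * l)).congr_deriv ?_
      rw [← Real.exp_add]
      field_simp
      congr 1; ring
    rw [intervalIntegral.integral_eq_sub_of_hasDerivAt hd
      (Continuous.intervalIntegrable (by fun_prop) _ _)]
    simp; ring
  · intro k _
    exact Continuous.intervalIntegrable (by fun_prop) _ _

lemma integral_sq_multivariateGaussian (μ : EuclideanSpace ℝ ι) {S : Matrix ι ι ℝ}
    (hS : S.PosSemidef) (i : ι) :
    ∫ x, (x i) ^ 2 ∂(multivariateGaussian μ S) = (μ i) ^ 2 + S i i := by
  have hm : MemLp (fun x : EuclideanSpace ℝ ι => x i) 2 (multivariateGaussian μ S) := by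
    have := (IsGaussian.memLp_two_id (μ := multivariateGaussian μ S)).continuousLinearMap_comp
      (EuclideanSpace.proj (𝕜 := ℝ) i)
    exact this
  have hv := variance_eval_multivariateGaussian (μ := μ) hS i
  have hmean : ∫ x, x i ∂(multivariateGaussian μ S) = μ i := by
    have := (EuclideanSpace.proj (𝕜 := ℝ) i).integral_comp_id_comm
      (μ := multivariateGaussian μ S) IsGaussian.integrable_id
    simpa using this
  rw [variance_eq_sub hm] at hv
  simp only [Pi.pow_apply] at hv
  rw [hmean] at hv
  linarith

lemma tendsto_exp_neg_mul {c : ℝ} (hc : 0 < c) :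
    Tendsto (fun t : ℝ => Real.exp (-(t * c))) atTop (𝓝 0) :=
  Real.tendsto_exp_atBot.comp (tendsto_neg_atTop_atBot.comp (tendsto_id.atTop_mul_const hc))

/-- The second moments of the Ornstein-Uhlenbeck law driven by a positive definite matrix. -/
lemma tendsto_sum_second_moment (hA : A.PosDef) (x₀ : ι → ℝ) :
    Tendsto (fun t : ℝ => ∑ i, ∫ x, (x i) ^ 2 ∂(multivariateGaussian
      (WithLp.toLp 2 (NormedSpace.exp (-(t • A)) *ᵥ x₀))
      (Matrix.of fun i j => ∫ s in (0 : ℝ)..t,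
        (NormedSpace.exp (-(s • A)) * (NormedSpace.exp (-(s • A)))ᵀ) i j))) atTop
      (𝓝 ((1 / 2) * A⁻¹.trace)) := by
  have hpos := fun k => hA.eigenvalues_pos k
  have hinv : A⁻¹ = eigenFun hA.isHermitian (fun l => l⁻¹) := by
    apply Matrix.inv_eq_left_inv
    refine (congrArg (_ * ·) (eigenFun_id hA.isHermitian).symm).trans ?_
    rw [eigenFun_mul, ← eigenFun_one hA.isHermitian]
    simp only [eigenFun]
    congr 3
    ext k
    exact inv_mul_cancel₀ (hpos k).ne'
  have hlim : Tendsto (fun t : ℝ => (∑ i, (eigenFun hA.isHermitian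
      (fun l => Real.exp (-(t * l))) *ᵥ x₀) i ^ 2) +
      ∑ k, (1 - Real.exp (-(t * (2 * hA.isHermitian.eigenvalues k)))) /
        (2 * hA.isHermitian.eigenvalues k)) atTop
      (𝓝 ((1 / 2) * A⁻¹.trace)) := by
    have h1 : Tendsto (fun t : ℝ => ∑ i, (eigenFun hA.isHermitian
        (fun l => Real.exp (-(t * l))) *ᵥ x₀) i ^ 2) atTop (𝓝 0) := by
      -- Zero is expanded to the shape of the sum so that the limit can be taken term by term.
      rw [show (0 : ℝ) = ∑ i : ι, (∑ j : ι, (∑ k : ι,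
        (hA.isHermitian.eigenvectorUnitary : Matrix ι ι ℝ) i k * 0 *
        (hA.isHermitian.eigenvectorUnitary : Matrix ι ι ℝ) j k) * x₀ j) ^ 2 by simp]
      simp only [Matrix.mulVec, dotProduct, eigenFun_apply]
      refine tendsto_finsetSum _ fun i _ => Tendsto.pow (tendsto_finsetSum _ fun j _ =>
        Tendsto.mul_const _ (tendsto_finsetSum _ fun k _ => Tendsto.mul_const _
          (Tendsto.const_mul _ (tendsto_exp_neg_mul (hpos k))))) 2
    have h2 : Tendsto (fun t : ℝ =>
        ∑ k, (1 - Real.exp (-(t * (2 * hA.isHermitian.eigenvalues k)))) /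
        (2 * hA.isHermitian.eigenvalues k)) atTop (𝓝 ((1 / 2) * A⁻¹.trace)) := by
      rw [hinv, eigenFun_trace, Finset.mul_sum]
      refine tendsto_finsetSum _ fun k _ => ?_
      have h3 := (((tendsto_exp_neg_mul (c := 2 * hA.isHermitian.eigenvalues k)
        (by linarith [hpos k])).const_sub 1).div_const (2 * hA.isHermitian.eigenvalues k))
      convert h3 using 2
      have := (hpos k).ne'
      field_simp
      simp
    simpa using h1.add h2
  refine hlim.congr' ?_
  -- Nonnegative `t` makes the covariance positive semidefinite, as the moment formula requires.
  filter_upwards [eventually_ge_atTop 0] with t ht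
  rw [integral_exp_mul_transpose hA]
  have hpsd : (eigenFun hA.isHermitian
      (fun l => (1 - Real.exp (-(2 * t * l))) / (2 * l))).PosSemidef := by
    apply eigenFun_posSemidef
    intro k
    have := hpos k
    apply div_nonneg _ (by linarith)
    have : Real.exp (-(2 * t * hA.isHermitian.eigenvalues k)) ≤ 1 := by
      rw [Real.exp_le_one_iff]
      have : 0 ≤ 2 * t * hA.isHermitian.eigenvalues k := by positivity
      linarith
    linarith
  simp only [integral_sq_multivariateGaussian _ hpsd]
  rw [Finset.sum_add_distrib, exp_neg_smul_eq_eigenFun hA.isHermitian]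
  congr 1
  have := eigenFun_trace hA.isHermitian (fun l => (1 - Real.exp (-(2 * t * l))) / (2 * l))
  rw [Matrix.trace] at this
  simp only [Matrix.diag] at this
  rw [this]
  refine Finset.sum_congr rfl fun k _ => ?_
  congr 4; ring

end Dynamics

/-! ### Positive definiteness of the follower block. -/

section Laplacian

variable {V : Type*} [Fintype V] [DecidableEq V] (G : SimpleGraph V) [DecidableRel G.Adj]

lemma dotProduct_followerLaplacian (S : Finset V) (x : {v // v ∉ S} → ℝ) :
    x ⬝ᵥ (followerLaplacian G S *ᵥ x) =
      Matrix.toLinearMap₂' ℝ (G.lapMatrix ℝ) (fun v => if h : v ∉ S then x ⟨v, h⟩ else 0)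
        (fun v => if h : v ∉ S then x ⟨v, h⟩ else 0) := by
  have hsum : ∀ f : V → ℝ, (∀ v ∈ S, f v = 0) → ∑ v, f v = ∑ v : {v // v ∉ S}, f v := by
    intro f hf
    rw [← Finset.sum_subtype (Finset.univ.filter fun v => v ∉ S) (by simp)]
    rw [Finset.sum_filter]
    refine Finset.sum_congr rfl fun v _ => ?_
    by_cases h : v ∈ S <;> simp [h, hf]
  rw [Matrix.toLinearMap₂'_apply']
  simp only [dotProduct, Matrix.mulVec]
  rw [hsum _ (by intro v hv; simp [hv])]
  refine Finset.sum_congr rfl fun u _ => ?_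
  rw [hsum _ (by intro v hv; simp [hv])]
  have h0 : ∀ v : {v // v ∉ S}, (if h : (v : V) ∉ S then x ⟨v, h⟩ else 0) = x v :=
    fun v => dif_pos v.2
  simp only [h0]
  rfl

lemma followerLaplacian_isHermitian (S : Finset V) : (followerLaplacian G S).IsHermitian :=
  (G.isHermitian_lapMatrix (R := ℝ)).submatrix _

/-- The quadratic form is the full Laplacian form of the extension by zero. Where it vanishes the
extension is constant, and a leader pins that constant to 0. -/
lemma followerLaplacian_posDef (hG : G.Connected) {S : Finset V} (hS : S.Nonempty) :
    (followerLaplacian G S).PosDef := by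
  rw [Matrix.posDef_iff_dotProduct_mulVec]
  refine ⟨followerLaplacian_isHermitian G S, fun x hx => ?_⟩
  simp only [star_trivial]
  rw [dotProduct_followerLaplacian]
  set y : V → ℝ := fun v => if h : v ∉ S then x ⟨v, h⟩ else 0 with hy
  have h0 : 0 ≤ Matrix.toLinearMap₂' ℝ (G.lapMatrix ℝ) y y := by
    rw [G.lapMatrix_toLinearMap₂' (R := ℝ)]
    positivity
  refine lt_of_le_of_ne h0 fun h => hx ?_
  replace h := (G.lapMatrix_toLinearMap₂'_apply'_eq_zero_iff_forall_reachable y).1 h.symm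
  obtain ⟨s, hs⟩ := hS
  ext v
  have := h v s (hG.preconnected _ _)
  simpa [hy, hs, v.2] using this

lemma tendsto_totalVariance (hG : G.Connected) {S : Finset V} (hS : S.Nonempty)
    (x₀ : {v // v ∉ S} → ℝ) :
    Tendsto (totalVariance G S x₀) atTop (𝓝 (coherence G S)) :=
  tendsto_sum_second_moment (followerLaplacian_posDef G hG hS) x₀

end Laplacian

/-! ### Distances in a tree. -/

section Tree

variable {V : Type*} {T : SimpleGraph V}

lemma exists_adj_dist_add_one (hT : T.Connected) {u x : V} (hne : u ≠ x) :
    ∃ w, T.Adj u w ∧ T.dist w x + 1 = T.dist u x := by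
  obtain ⟨p, hp⟩ := hT.exists_walk_length_eq_dist u x
  cases p with
  | nil => exact absurd rfl hne
  | @cons _ w _ hadj q =>
    refine ⟨w, hadj, ?_⟩
    have h1 := SimpleGraph.dist_le q
    have h2 : T.dist u x ≤ T.dist u w + T.dist w x := hT.dist_triangle
    rw [SimpleGraph.dist_eq_one_iff_adj.2 hadj] at h2
    rw [SimpleGraph.Walk.length_cons] at hp
    omega

/-- Both neighbours begin a geodesic from `u` to `x`, and paths in a tree are unique. -/
lemma adj_dist_add_one_unique (hT : T.IsTree) {u x w w' : V} (hw : T.Adj u w)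
    (hw' : T.Adj u w') (h : T.dist w x + 1 = T.dist u x) (h' : T.dist w' x + 1 = T.dist u x) :
    w = w' := by
  obtain ⟨p, hp⟩ := hT.connected.exists_walk_length_eq_dist w x
  obtain ⟨p', hp'⟩ := hT.connected.exists_walk_length_eq_dist w' x
  have h1 : (SimpleGraph.Walk.cons hw p).IsPath :=
    SimpleGraph.Walk.isPath_of_length_eq_dist _ (by simp; omega)
  have h2 : (SimpleGraph.Walk.cons hw' p').IsPath :=
    SimpleGraph.Walk.isPath_of_length_eq_dist _ (by simp; omega)
  have := (hT.existsUnique_path u x).unique h1 h2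
  simpa using congrArg SimpleGraph.Walk.snd this

/-- If removing the edge `pz` separates `u` from `r`, then the path from `u` to `r` uses it. -/
lemma dist_eq_of_separated (hT : T.IsTree) {p z r : V} (hadj : T.Adj p z)
    (hr : T.dist r z = T.dist r p + 1) (u : V) (hu : T.dist u p = T.dist u z + 1) :
    T.dist u r = T.dist u z + 1 + T.dist p r := by
  have hpz : T.dist p z = 1 := SimpleGraph.dist_eq_one_iff_adj.2 hadj
  have key : ∀ n u, T.dist u z = n → T.dist u p = T.dist u z + 1 →
      T.dist u r = T.dist u z + 1 + T.dist p r := by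
    intro n
    induction n using Nat.strong_induction_on with
    | _ n ih =>
      intro u hn hu
      by_cases huz : u = z
      · subst huz
        rw [T.dist_comm, hr, T.dist_comm (u := p)]; simp; omega
      have step : ∀ v w, T.Adj v w → T.dist w z + 1 = T.dist v z → T.dist v p = T.dist v z + 1 →
          T.dist w p = T.dist w z + 1 := by
        intro v w hvw h1 h2
        have h3 : T.dist v p ≤ T.dist v w + T.dist w p := hT.connected.dist_triangle
        have h4 : T.dist w p ≤ T.dist w z + T.dist z p := hT.connected.dist_triangle
        rw [SimpleGraph.dist_eq_one_iff_adj.2 hvw] at h3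
        rw [T.dist_comm (u := z), hpz] at h4
        omega
      obtain ⟨v, huv, hv⟩ := exists_adj_dist_add_one hT.connected huz
      have hvp := step u v huv hv hu
      have hvr := ih (T.dist v z) (by omega) v rfl hvp
      -- `q` is the next node after `v` on the way to `r`. If `u` were nearer to `r` than `v`,
      -- uniqueness would give `u = q`, but `q` is strictly nearer to `p`.
      obtain ⟨q, hvq, hqr, hqp⟩ : ∃ q, T.Adj v q ∧ T.dist q r + 1 = T.dist v r ∧
          T.dist q p < T.dist u p := by
        by_cases hvz : v = z
        · subst hvz
          refine ⟨p, hadj.symm, ?_, ?_⟩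
          · rw [hvr]; simp; omega
          · simp; omega
        · obtain ⟨q, hvq, hq⟩ := exists_adj_dist_add_one hT.connected hvz
          have hqp := step v q hvq hq hvp
          have hqr := ih (T.dist q z) (by omega) q rfl hqp
          exact ⟨q, hvq, by omega, by omega⟩
      rcases hT.dist_eq_dist_add_one_of_adj r huv with h | h
      · rw [T.dist_comm (u := u), h, T.dist_comm (u := r), hvr]; omega
      · exfalso
        have : u = q := adj_dist_add_one_unique hT huv.symm hvq
          (by rw [T.dist_comm, ← h, T.dist_comm]) hqr
        subst this
        omega
  exact key _ u rfl hu

end Tree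

/-! ### Explicit inverse of the grounded tree Laplacian. -/

section Inverse

variable {V : Type*} [Fintype V] [DecidableEq V] {T : SimpleGraph V} [DecidableRel T.Adj]

/-- Away from `x`, exactly one neighbour is nearer to `x` and all others are farther; at `x` all are
farther. -/
lemma lapMatrix_mulVec_dist (hT : T.IsTree) (x u : V) :
    (T.lapMatrix ℝ *ᵥ fun w => (T.dist w x : ℝ)) u =
      2 - T.degree u - (if u = x then 2 else 0) := by
  rw [SimpleGraph.lapMatrix_mulVec_apply]
  by_cases hux : u = x
  · subst hux
    have : ∀ w ∈ T.neighborFinset u, (T.dist w u : ℝ) = 1 := by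
      intro w hw
      rw [SimpleGraph.mem_neighborFinset] at hw
      exact_mod_cast SimpleGraph.dist_eq_one_iff_adj.2 hw.symm
    rw [Finset.sum_congr rfl this]
    simp
  · obtain ⟨p, hup, hp⟩ := exists_adj_dist_add_one hT.connected hux
    have : ∀ w ∈ T.neighborFinset u,
        (T.dist w x : ℝ) = (T.dist u x + 1) - (if w = p then 2 else 0) := by
      intro w hw
      rw [SimpleGraph.mem_neighborFinset] at hw
      split_ifs with h
      · subst h; rw [← hp]; push_cast; ring
      · rcases hT.dist_eq_dist_add_one_of_adj x hw with h' | h'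
        · rw [T.dist_comm, T.dist_comm (u := x)] at h'
          exact absurd (adj_dist_add_one_unique hT hw hup h'.symm hp) h
        · rw [T.dist_comm, h', T.dist_comm (u := x)]; simp
    rw [Finset.sum_congr rfl this, Finset.sum_sub_distrib, Finset.sum_const,
      Finset.sum_ite_eq' (T.neighborFinset u) p]
    simp [hup, hux]
    ring

/-- Since `g` vanishes on leader rows, sums over followers extend to all of `V`, so the full
Laplacian can be used to verify an inverse. -/
lemma trace_inv_followerLaplacian {S : Finset V} (g : V → V → ℝ)
    (hg : ∀ w ∈ S, ∀ v, g w v = 0)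
    (hL : ∀ u ∉ S, ∀ v ∉ S, (T.lapMatrix ℝ *ᵥ fun w => g w v) u = if u = v then 1 else 0) :
    (followerLaplacian T S)⁻¹.trace = ∑ v, g v v := by
  have hsum : ∀ f : V → ℝ, (∀ v ∈ S, f v = 0) → ∑ v, f v = ∑ v : {v // v ∉ S}, f v := by
    intro f hf
    rw [← Finset.sum_subtype (Finset.univ.filter fun v => v ∉ S) (by simp)]
    rw [Finset.sum_filter]
    refine Finset.sum_congr rfl fun v _ => ?_
    by_cases h : v ∈ S <;> simp [h, hf]
  have hinv : (followerLaplacian T S)⁻¹ = Matrix.of fun u v : {v // v ∉ S} => g u v := by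
    apply Matrix.inv_eq_right_inv
    ext u v
    rw [Matrix.mul_apply, Matrix.one_apply, ← if_congr Subtype.ext_iff.symm rfl rfl,
      ← hL u u.2 v v.2, Matrix.mulVec, dotProduct, hsum _ (by intro w hw; simp [hg w hw])]
    rfl
  rw [hinv, hsum _ (fun v hv => hg v hv v)]
  rfl

/-- The inverse of the Laplacian grounded at `x`, as a function on pairs of nodes of a tree. -/
noncomputable def treeGreen (T : SimpleGraph V) (x u v : V) : ℝ :=
  (T.dist u x + T.dist v x - T.dist u v) / 2

omit [Fintype V] [DecidableEq V] [DecidableRel T.Adj] in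
@[simp] lemma treeGreen_ground (x v : V) : treeGreen T x x v = 0 := by
  simp [treeGreen, T.dist_comm]

lemma lapMatrix_mulVec_treeGreen (hT : T.IsTree) (x v u : V) :
    (T.lapMatrix ℝ *ᵥ fun w => treeGreen T x w v) u =
      (if u = v then 1 else 0) - (if u = x then 1 else 0) := by
  have h : (fun w => treeGreen T x w v) = (1 / 2 : ℝ) • ((fun w => (T.dist w x : ℝ)) +
      (T.dist v x : ℝ) • (fun _ => (1 : ℝ)) - fun w => (T.dist w v : ℝ)) := by
    ext w; simp [treeGreen]; ring
  rw [h, Matrix.mulVec_smul, Matrix.mulVec_sub, Matrix.mulVec_add, Matrix.mulVec_smul,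
    SimpleGraph.lapMatrix_mulVec_const_eq_zero]
  simp only [Pi.smul_apply, Pi.sub_apply, Pi.add_apply, lapMatrix_mulVec_dist hT, smul_eq_mul,
    Pi.zero_apply]
  split_ifs <;> ring

lemma trace_inv_singleton (hT : T.IsTree) (x : V) :
    (followerLaplacian T {x})⁻¹.trace = ∑ u, (T.dist u x : ℝ) := by
  rw [trace_inv_followerLaplacian (treeGreen T x)]
  · refine Finset.sum_congr rfl fun v _ => ?_
    simp [treeGreen]
  · simp
  · intro u hu v _
    rw [Finset.mem_singleton] at hu
    rw [lapMatrix_mulVec_treeGreen hT, if_neg hu, sub_zero]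

lemma trace_inv_pair (hT : T.IsTree) {x y : V} (hne : x ≠ y) :
    (followerLaplacian T {x, y})⁻¹.trace =
      (∑ u, (T.dist u x : ℝ) + ∑ u, (T.dist u y : ℝ)) / 2 -
      (∑ u, ((T.dist u x : ℝ) - T.dist u y) ^ 2) / (4 * T.dist x y) -
      Fintype.card V * T.dist x y / 4 := by
  have hd : (T.dist x y : ℝ) ≠ 0 := by
    exact_mod_cast (hT.connected.pos_dist_of_ne hne).ne'
  -- The correction makes the kernel vanish at `y` as well; the denominator is `treeGreen T x y y =
  -- d(x,y)`.
  rw [trace_inv_followerLaplacian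
    (fun u v => treeGreen T x u v - treeGreen T x u y * treeGreen T x y v / T.dist x y)]
  · rw [← Finset.sum_add_distrib, Finset.sum_div, Finset.sum_div, ← Finset.sum_sub_distrib,
      ← nsmul_eq_mul, ← Finset.card_univ, smul_div_assoc, ← Finset.sum_const,
      ← Finset.sum_sub_distrib]
    refine Finset.sum_congr rfl fun v _ => ?_
    simp only [treeGreen, SimpleGraph.dist_self, T.dist_comm (u := y)]
    field_simp
    push_cast
    ring
  · intro w hw v
    rw [Finset.mem_insert, Finset.mem_singleton] at hw
    rcases hw with rfl | rfl
    · simp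
    · simp only [treeGreen, SimpleGraph.dist_self, T.dist_comm (u := w)]
      rw [T.dist_comm (u := x)] at hd
      rw [T.dist_comm (u := x)]
      field_simp
      push_cast; ring
  · intro u hu v _
    rw [Finset.mem_insert, Finset.mem_singleton, not_or] at hu
    have h : (fun w => treeGreen T x w v - treeGreen T x w y * treeGreen T x y v / T.dist x y) =
        (fun w => treeGreen T x w v) -
          (treeGreen T x y v / T.dist x y) • fun w => treeGreen T x w y := by
      ext w; simp; ring
    rw [h, Matrix.mulVec_sub, Matrix.mulVec_smul]
    simp [lapMatrix_mulVec_treeGreen hT, hu.1, hu.2]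

end Inverse

/-! ### The inequality for sequences decaying by a factor of four. -/

section Numeric

/-- `∑_{j=1}^{m} s (e + j)`. -/
def armSum (s : ℕ → ℝ) (e m : ℕ) : ℝ := ∑ j ∈ Finset.range m, s (e + j + 1)

/-- `∑_{j=1}^{m} (2j - 1) s (e + j)`. -/
def armMoment (s : ℕ → ℝ) (e m : ℕ) : ℝ := ∑ j ∈ Finset.range m, (2 * j + 1 : ℝ) * s (e + j + 1)

/-- The amount by which a pair of leaders, whose paths from their deepest common ancestor at
level `e` have lengths `a` and `b`, exceeds the single leader at the root, times `2 (a + b)`. -/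
def pairExcess (s : ℕ → ℝ) (e a b : ℕ) : ℝ :=
  (a + b) * (s 0 * e - 2 * armSum s 0 e) + s 0 * a * b -
    (2 * b * armSum s e a + armMoment s e a + 2 * a * armSum s e b + armMoment s e b)

variable {s : ℕ → ℝ} (hs0 : ∀ k, 0 ≤ s k) (hs : ∀ k, 4 * s (k + 1) ≤ s k)

include hs0 hs

lemma armSum_le (e m : ℕ) : armSum s e m ≤ 4 / 3 * s (e + 1) := by
  -- The added term is the geometric tail `∑_{i≥1} 4⁻ⁱ = 1/3` still to come.
  have key : ∀ m, armSum s e (m + 1) + 1 / 3 * s (e + m + 1) ≤ 4 / 3 * s (e + 1) := by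
    intro m
    induction m with
    | zero => simp [armSum]; linarith
    | succ m ih =>
      rw [armSum, Finset.sum_range_succ, ← armSum]
      have := hs (e + m + 1)
      rw [show e + (m + 1) + 1 = e + m + 1 + 1 by ring]
      linarith
  cases m with
  | zero => have := hs0 (e + 1); simp [armSum, this]
  | succ m => linarith [key m, hs0 (e + m + 1)]

lemma armMoment_le (e m : ℕ) : armMoment s e m ≤ 20 / 9 * s (e + 1) := by
  -- Again the remaining tail: `∑_{i≥1} (2m + 2i + 1) 4⁻ⁱ = 2m/3 + 11/9`.
  have key : ∀ m : ℕ, armMoment s e (m + 1) + (2 / 3 * m + 11 / 9) * s (e + m + 1) ≤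
      20 / 9 * s (e + 1) := by
    intro m
    induction m with
    | zero => simp [armMoment]; linarith
    | succ m ih =>
      rw [armMoment, Finset.sum_range_succ, ← armMoment]
      have h1 := mul_le_mul_of_nonneg_left (hs (e + m + 1))
        (show (0 : ℝ) ≤ 2 / 3 * m + 11 / 9 by positivity)
      rw [show e + (m + 1) + 1 = e + m + 1 + 1 by ring]
      push_cast
      linarith
  cases m with
  | zero => have := hs0 (e + 1); simp [armMoment, this]
  | succ m =>
    have : 0 ≤ (2 / 3 * m + 11 / 9) * s (e + m + 1) := mul_nonneg (by positivity) (hs0 _)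
    linarith [key m]

lemma armSum_zero_le (e : ℕ) : armSum s 0 e ≤ e * s 1 := by
  have hanti : ∀ k, s (k + 1) ≤ s 1 := by
    intro k
    induction k with
    | zero => exact le_rfl
    | succ k ih => linarith [hs (k + 1), hs0 (k + 1 + 1)]
  have := Finset.sum_le_sum (s := Finset.range e) (fun j _ => hanti j)
  simpa [armSum] using this

omit hs0 hs in
lemma armSum_one (e : ℕ) : armSum s e 1 = s (e + 1) := by simp [armSum]

omit hs0 hs in
lemma armMoment_one (e : ℕ) : armMoment s e 1 = s (e + 1) := by simp [armMoment]

omit hs0 hs in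
lemma pairExcess_comm (e a b : ℕ) : pairExcess s e a b = pairExcess s e b a := by
  simp only [pairExcess]; ring

/-- Leaving the root costs at least `2 s 1` per unit of `a + b`, while the arms gain at most `64/9 ·
s (e+1) ≤ 16/9 · s 1` per unit. -/
lemma pairExcess_gt_of_pos (hs1 : 0 < s 1) {e a b : ℕ} (he : 0 < e) (hab : 0 < a + b) :
    0 < pairExcess s e a b + (a + b) * s 1 := by
  have hd : (1 : ℝ) ≤ a + b := by exact_mod_cast hab
  have he' : (1 : ℝ) ≤ e := by exact_mod_cast he
  have ht : 4 * s (e + 1) ≤ s 1 := by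
    have hanti : ∀ k, 4 * s (k + 1 + 1) ≤ s 1 := by
      intro k
      induction k with
      | zero => exact hs 1
      | succ k ih => linarith [hs (k + 1 + 1), hs0 (k + 1 + 1 + 1), hs0 (k + 1 + 1)]
    obtain ⟨k, rfl⟩ := Nat.exists_eq_succ_of_ne_zero he.ne'
    exact hanti k
  have h0 := hs 0
  have hroot : 2 * s 1 ≤ s 0 * e - 2 * armSum s 0 e := by
    have := armSum_zero_le hs0 hs e
    nlinarith
  have h1 : (a + b) * (2 * s 1) ≤ ((a : ℝ) + b) * (s 0 * e - 2 * armSum s 0 e) :=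
    mul_le_mul_of_nonneg_left hroot (by positivity)
  have h2 : 0 ≤ s 0 * a * b := mul_nonneg (mul_nonneg (hs0 0) (by positivity)) (by positivity)
  have h3 := mul_le_mul_of_nonneg_left (armSum_le hs0 hs e a) (show (0 : ℝ) ≤ 2 * b by positivity)
  have h4 := mul_le_mul_of_nonneg_left (armSum_le hs0 hs e b) (show (0 : ℝ) ≤ 2 * a by positivity)
  have h5 := armMoment_le hs0 hs e a
  have h6 := armMoment_le hs0 hs e b
  have h7 := mul_le_mul_of_nonneg_left ht (show (0 : ℝ) ≤ (a : ℝ) + b by positivity)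
  have h8 : s (e + 1) ≤ (a + b) * s (e + 1) := le_mul_of_one_le_left (hs0 _) hd
  have h9 : 0 < (a + b) * s 1 := by positivity
  rw [pairExcess]
  nlinarith

lemma pairExcess_gt_of_ancestor (hs1 : 0 < s 1) {a : ℕ} (ha : 2 ≤ a) :
    0 < pairExcess s 0 a 0 + (a + 0) * s 1 := by
  simp only [pairExcess, armSum, armMoment, Finset.sum_range_zero]
  rcases Nat.lt_or_ge 2 a with h | h
  · have h3 : (3 : ℝ) ≤ a := by exact_mod_cast h
    have := armMoment_le hs0 hs 0 a
    simp only [armMoment] at this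
    simp only [zero_add] at this ⊢
    push_cast
    nlinarith
  -- The general moment bound `20/9` exceeds 2, so this case uses the exact value `s 1 + 3 s 2 ≤ 7/4
  -- · s 1`.
  · obtain rfl : a = 2 := by omega
    have := hs 1
    norm_num [Finset.sum_range_succ] at *
    linarith

lemma pairExcess_gt_of_branch (hs1 : 0 < s 1) (hroot : 4 * s 1 < s 0) {a b : ℕ} (hb : 1 ≤ b)
    (hab : b ≤ a) : 0 < pairExcess s 0 a b + (a + b) * s 1 := by
  have h0 : armSum s 0 0 = 0 := by simp [armSum]
  have hab' : (b : ℝ) ≤ a := by exact_mod_cast hab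
  have hA := armSum_le hs0 hs 0 a
  have hB := armMoment_le hs0 hs 0 a
  rcases Nat.lt_or_ge 1 b with h | h
  · have hb2 : (2 : ℝ) ≤ b := by exact_mod_cast h
    have h1 : 4 * s 1 * (a * b) < s 0 * (a * b) :=
      mul_lt_mul_of_pos_right hroot (by nlinarith)
    have h3 := mul_le_mul_of_nonneg_left hA (show (0 : ℝ) ≤ 2 * b by positivity)
    have h4 := mul_le_mul_of_nonneg_left (armSum_le hs0 hs 0 b)
      (show (0 : ℝ) ≤ 2 * a by positivity)
    have h6 := armMoment_le hs0 hs 0 b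
    have h7 : (0 : ℝ) < 4 * (a * b) + (a + b) - 8 / 3 * (a + b) - 40 / 9 := by nlinarith
    have h8 := mul_pos h7 hs1
    simp only [pairExcess, h0, zero_add] at *
    push_cast
    nlinarith
  -- The bounds used for `b ≥ 2` are too weak here, so the short arm is evaluated exactly. At `a = b
  -- = 1` the claim is precisely `hroot`.
  · obtain rfl : b = 1 := by omega
    rcases Nat.lt_or_ge 1 a with h' | h'
    · have ha2 : (2 : ℝ) ≤ a := by exact_mod_cast h'
      have h1 : 4 * s 1 * a < s 0 * a := mul_lt_mul_of_pos_right hroot (by linarith)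
      simp only [pairExcess, h0, armSum_one, armMoment_one, zero_add] at *
      push_cast
      nlinarith
    · obtain rfl : a = 1 := by omega
      simp only [pairExcess, h0, armSum_one, armMoment_one, zero_add] at *
      push_cast
      linarith

/-- A root-child pair is strictly better than every other pair. -/
lemma pairExcess_gt (hs1 : 0 < s 1) (hroot : 4 * s 1 < s 0) {e a b : ℕ} (hab : 0 < a + b)
    (h : ¬ (e = 0 ∧ a + b = 1)) : 0 < pairExcess s e a b + (a + b) * s 1 := by
  rcases Nat.eq_zero_or_pos e with rfl | he
  swap
  · exact pairExcess_gt_of_pos hs0 hs hs1 he hab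
  wlog hle : b ≤ a generalizing a b
  · rw [pairExcess_comm, add_comm (a : ℝ)]
    exact this (by omega) (by omega) (by omega)
  rcases Nat.eq_zero_or_pos b with rfl | hb
  · have := pairExcess_gt_of_ancestor hs0 hs hs1 (a := a) (by omega)
    simpa using this
  · exact pairExcess_gt_of_branch hs0 hs hs1 hroot hb hle

omit hs0 hs in
lemma pairExcess_root_child {a b : ℕ} (hab : a + b = 1) : pairExcess s 0 a b = -s 1 := by
  obtain ⟨rfl, rfl⟩ | ⟨rfl, rfl⟩ : (a = 1 ∧ b = 0) ∨ (a = 0 ∧ b = 1) := by omega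
  all_goals simp [pairExcess, armSum, armMoment]

end Numeric

/-! ### Subtrees and the effect of crossing one edge. -/

section Subtree

variable {V : Type*} [Fintype V] [DecidableEq V]

/-- The nodes of the subtree below `z` in the tree `T` rooted at `r`. -/
noncomputable def subtree (T : SimpleGraph V) (r z : V) : Finset V :=
  Finset.univ.filter fun u => T.dist u r = T.dist u z + T.dist z r

variable {T : SimpleGraph V} {r : V}

omit [DecidableEq V] in
lemma mem_subtree {z u : V} : u ∈ subtree T r z ↔ T.dist u r = T.dist u z + T.dist z r := by
  simp [subtree]

omit [DecidableEq V] in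
lemma subtree_root : subtree T r r = Finset.univ := by
  ext u; simp [mem_subtree]

section Parent

variable (hT : T.IsTree) {p z : V} (hpz : T.Adj p z) (hp : T.dist z r = T.dist p r + 1)
include hT hpz hp

omit [DecidableEq V] in
lemma dist_parent_of_mem {u : V} (hu : u ∈ subtree T r z) : T.dist u p = T.dist u z + 1 := by
  rw [mem_subtree] at hu
  have h1 : T.dist u r ≤ T.dist u p + T.dist p r := hT.connected.dist_triangle
  rcases hT.dist_eq_dist_add_one_of_adj u hpz with h | h <;> omega

omit [DecidableEq V] in
lemma dist_of_notMem {u : V} (hu : u ∉ subtree T r z) : T.dist u z = T.dist u p + 1 := by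
  rcases hT.dist_eq_dist_add_one_of_adj u hpz with h | h
  · exfalso
    apply hu
    rw [mem_subtree, dist_eq_of_separated hT hpz (by rw [T.dist_comm, hp, T.dist_comm]) u h]
    omega
  · exact h

omit [DecidableEq V] in
lemma dist_eq_add_of_mem_of_notMem {x u : V} (hx : x ∉ subtree T r z) (hu : u ∈ subtree T r z) :
    T.dist u x = T.dist u z + T.dist x z := by
  have h1 := dist_of_notMem hT hpz hp hx
  rw [dist_eq_of_separated hT hpz h1 u (dist_parent_of_mem hT hpz hp hu), h1,
    T.dist_comm (u := p)]
  omega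

lemma sum_dist_eq_parent :
    ∑ u, (T.dist u z : ℝ) = ∑ u, (T.dist u p : ℝ) + (Fintype.card V - 2 * (subtree T r z).card) := by
  have h : ∀ u, (T.dist u z : ℝ) = T.dist u p + (1 - 2 * if u ∈ subtree T r z then 1 else 0) := by
    intro u
    split_ifs with hu
    · rw [dist_parent_of_mem hT hpz hp hu]; push_cast; ring
    · rw [dist_of_notMem hT hpz hp hu]; push_cast; ring
  rw [Finset.sum_congr rfl fun u _ => h u]
  simp [Finset.sum_add_distrib, Finset.sum_sub_distrib]
  ring

/-- On the subtree `d(u,x) - d(u,p)` is the constant `d(x,z) - 1`, so the correction to a uniform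
shift by one involves only the subtree's size. -/
lemma sum_sq_dist_sub_eq_parent {x : V} (hx : x ∉ subtree T r z) :
    ∑ u, ((T.dist u x : ℝ) - T.dist u z) ^ 2 =
      ∑ u, ((T.dist u x : ℝ) - T.dist u p) ^ 2 + Fintype.card V +
        (subtree T r z).card * (4 * T.dist x z - 4) -
        2 * (∑ u, (T.dist u x : ℝ) - ∑ u, (T.dist u p : ℝ)) := by
  have h : ∀ u, ((T.dist u x : ℝ) - T.dist u z) ^ 2 = ((T.dist u x : ℝ) - T.dist u p) ^ 2 + 1 +
      (if u ∈ subtree T r z then 1 else 0) * (4 * T.dist x z - 4) -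
      2 * ((T.dist u x : ℝ) - T.dist u p) := by
    intro u
    split_ifs with hu
    · rw [dist_parent_of_mem hT hpz hp hu, dist_eq_add_of_mem_of_notMem hT hpz hp hx hu]
      push_cast; ring
    · rw [dist_of_notMem hT hpz hp hu]; push_cast; ring
  rw [Finset.sum_congr rfl fun u _ => h u]
  simp [Finset.sum_add_distrib, Finset.sum_sub_distrib, ← Finset.mul_sum]
  ring

end Parent

variable [DecidableRel T.Adj]

omit [DecidableEq V] in
lemma mem_children {z c : V} :
    c ∈ children T r z ↔ T.Adj z c ∧ T.dist c r = T.dist z r + 1 := by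
  simp [children]

lemma subtree_eq_insert (hT : T.IsTree) (z : V) :
    subtree T r z = insert z ((children T r z).biUnion (subtree T r)) := by
  ext u
  rw [Finset.mem_insert, Finset.mem_biUnion]
  constructor
  · intro hu
    by_cases huz : u = z
    · exact Or.inl huz
    obtain ⟨c, hzc, hc⟩ := exists_adj_dist_add_one hT.connected (Ne.symm huz)
    rw [mem_subtree] at hu
    rw [T.dist_comm, T.dist_comm (u := z)] at hc
    have h1 : T.dist u r ≤ T.dist u c + T.dist c r := hT.connected.dist_triangle
    have h2 : T.dist c r = T.dist z r + 1 := by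
      have := hT.dist_eq_dist_add_one_of_adj r hzc
      rw [T.dist_comm, T.dist_comm (u := r)] at this
      omega
    exact Or.inr ⟨c, mem_children.2 ⟨hzc, h2⟩, mem_subtree.2 (by omega)⟩
  · rintro (rfl | ⟨c, hc, hu⟩)
    · rw [mem_subtree]; simp
    · rw [mem_children] at hc
      have := dist_parent_of_mem hT hc.1 hc.2 hu
      rw [mem_subtree] at hu ⊢
      omega

lemma sum_subtree (hT : T.IsTree) (z : V) (f : V → ℝ) :
    ∑ u ∈ subtree T r z, f u = f z + ∑ c ∈ children T r z, ∑ u ∈ subtree T r c, f u := by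
  rw [subtree_eq_insert hT, Finset.sum_insert, Finset.sum_biUnion]
  · intro c hc c' hc' hne
    rw [Function.onFun, Finset.disjoint_left]
    intro u hu hu'
    have h := mem_children.1 hc
    have h' := mem_children.1 hc'
    have h1 := dist_parent_of_mem hT h.1 h.2 hu
    have h2 := dist_parent_of_mem hT h'.1 h'.2 hu'
    rw [T.dist_comm, T.dist_comm (u := u)] at h1 h2
    exact hne (adj_dist_add_one_unique hT h.1 h'.1 h1.symm h2.symm)
  · rw [Finset.mem_biUnion]
    rintro ⟨c, hc, hu⟩
    have h := mem_children.1 hc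
    have h1 := dist_parent_of_mem hT h.1 h.2 hu
    simp at h1

end Subtree

/-! ### Subtree sizes, distance sums and coherence in a perfect tree. -/

section Perfect

variable {V : Type*} [Fintype V] [DecidableEq V] {T : SimpleGraph V} [DecidableRel T.Adj] {r : V}
  {M h : ℕ}

/-- The number of nodes below (and including) a node at level `k` of a perfect `M`-ary tree of
height `h`. -/
noncomputable def subtreeSize (M h k : ℕ) : ℝ := ((M : ℝ) ^ (h + 1 - k) - 1) / (M - 1)

lemma subtreeSize_succ (hM : 2 ≤ M) {k : ℕ} (hk : k ≤ h) :
    subtreeSize M h k = M * subtreeSize M h (k + 1) + 1 := by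
  have : (M : ℝ) - 1 ≠ 0 := by
    have : (2 : ℝ) ≤ M := by exact_mod_cast hM
    linarith
  rw [subtreeSize, subtreeSize, show h + 1 - k = (h + 1 - (k + 1)) + 1 by omega, pow_succ]
  field_simp
  ring

/-- Truncated subtraction gives exponent 0, so the size recursion also holds at leaf level. -/
lemma subtreeSize_of_lt {k : ℕ} (hk : h < k) : subtreeSize M h k = 0 := by
  rw [subtreeSize, show h + 1 - k = 0 by omega]; simp

lemma subtreeSize_nonneg (hM : 2 ≤ M) (k : ℕ) : 0 ≤ subtreeSize M h k := by
  have h2 : (2 : ℝ) ≤ M := by exact_mod_cast hM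
  exact div_nonneg (sub_nonneg.2 (one_le_pow₀ (by linarith))) (by linarith)

lemma four_mul_subtreeSize_le (hM : 4 ≤ M) (k : ℕ) :
    4 * subtreeSize M h (k + 1) ≤ subtreeSize M h k := by
  rcases Nat.lt_or_ge h k with hk | hk
  · rw [subtreeSize_of_lt hk, subtreeSize_of_lt (by omega : h < k + 1)]; simp
  · have h4 : (4 : ℝ) ≤ M := by exact_mod_cast hM
    rw [subtreeSize_succ (by omega) hk]
    nlinarith [subtreeSize_nonneg (h := h) (by omega : 2 ≤ M) (k + 1)]

variable (hT : IsPerfectMAryTree T r M h)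
include hT

omit [DecidableEq V] in
lemma IsPerfectMAryTree.dist_root_le (v : V) : T.dist v r ≤ h := by
  obtain ⟨z, -, hz⟩ := Finset.exists_max_image Finset.univ (fun z => T.dist z r) ⟨v, by simp⟩
  have : children T r z = ∅ := by
    rw [Finset.eq_empty_iff_forall_notMem]
    intro c hc
    have := hz c (by simp)
    have := (mem_children.1 hc).2
    omega
  rw [← hT.level_leaf z this]
  exact hz v (by simp)

omit [DecidableEq V] in
lemma IsPerfectMAryTree.children_eq_empty {z : V} (hz : T.dist z r = h) : children T r z = ∅ := by
  rw [Finset.eq_empty_iff_forall_notMem]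
  intro c hc
  have := (mem_children.1 hc).2
  have := hT.dist_root_le c
  omega

omit [DecidableEq V] in
lemma IsPerfectMAryTree.card_children_of_lt {z : V} (hz : T.dist z r < h) :
    (children T r z).card = M :=
  hT.card_children z fun h0 => hz.ne (hT.level_leaf z h0)

lemma IsPerfectMAryTree.card_subtree (hM : 2 ≤ M) (z : V) :
    ((subtree T r z).card : ℝ) = subtreeSize M h (T.dist z r) := by
  obtain ⟨n, hn⟩ : ∃ n, T.dist z r + n = h := ⟨_, Nat.add_sub_of_le (hT.dist_root_le z)⟩
  induction n generalizing z with
  | zero =>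
    have := sum_subtree hT.isTree z (r := r) (fun _ => 1)
    rw [hT.children_eq_empty (by omega)] at this
    rw [subtreeSize_succ hM (by omega), subtreeSize_of_lt (by omega)]
    simpa using this
  | succ n ih =>
    have h1 := sum_subtree hT.isTree z (r := r) (fun _ => 1)
    have h2 : ∀ c ∈ children T r z, (∑ u ∈ subtree T r c, 1 : ℝ) =
        subtreeSize M h (T.dist z r + 1) := by
      intro c hc
      rw [← (mem_children.1 hc).2, ← ih c (by rw [(mem_children.1 hc).2]; omega)]
      simp
    rw [Finset.sum_congr rfl h2] at h1
    simp only [Finset.sum_const, nsmul_eq_mul, mul_one] at h1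
    rw [hT.card_children_of_lt (by omega)] at h1
    rw [subtreeSize_succ hM (by omega)]
    linarith

lemma IsPerfectMAryTree.card_eq (hM : 2 ≤ M) : (Fintype.card V : ℝ) = subtreeSize M h 0 := by
  have := hT.card_subtree hM r
  rwa [subtree_root, Finset.card_univ, SimpleGraph.dist_self] at this

lemma IsPerfectMAryTree.sum_dist_subtree (hM : 2 ≤ M) (z : V) :
    ∑ u ∈ subtree T r z, (T.dist u z : ℝ) =
      ((h : ℝ) - T.dist z r + 1) * (M : ℝ) ^ (h + 1 - T.dist z r) / (M - 1) -
        M * ((M : ℝ) ^ (h + 1 - T.dist z r) - 1) / (M - 1) ^ 2 := by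
  have hM1 : (M : ℝ) - 1 ≠ 0 := by
    have : (2 : ℝ) ≤ M := by exact_mod_cast hM
    linarith
  obtain ⟨n, hn⟩ : ∃ n, T.dist z r + n = h := ⟨_, Nat.add_sub_of_le (hT.dist_root_le z)⟩
  induction n generalizing z with
  | zero =>
    rw [sum_subtree hT.isTree z, hT.children_eq_empty (by omega),
      show h + 1 - T.dist z r = 1 by omega, ← hn]
    simp
    field_simp
    simp
  | succ n ih =>
    rw [sum_subtree hT.isTree z]
    have h2 : ∀ c ∈ children T r z, (∑ u ∈ subtree T r c, (T.dist u z : ℝ)) =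
        ((n : ℝ) + 1) * (M : ℝ) ^ (n + 1) / (M - 1) -
        M * ((M : ℝ) ^ (n + 1) - 1) / (M - 1) ^ 2 + ((M : ℝ) ^ (n + 1) - 1) / (M - 1) := by
      intro c hc
      have hc' := mem_children.1 hc
      have h3 : ∀ u ∈ subtree T r c, (T.dist u z : ℝ) = T.dist u c + 1 := by
        intro u hu
        exact_mod_cast dist_parent_of_mem hT.isTree hc'.1 hc'.2 hu
      have h4 := hT.card_subtree hM c
      rw [subtreeSize, show h + 1 - T.dist c r = n + 1 by omega] at h4
      rw [Finset.sum_congr rfl h3, Finset.sum_add_distrib, ih c (by omega), Finset.sum_const,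
        nsmul_eq_mul, mul_one, h4, show h + 1 - T.dist c r = n + 1 by omega]
      have : (h : ℝ) - T.dist c r = n := by
        rw [← hn, hc'.2]; push_cast; ring
      rw [this]
    rw [Finset.sum_congr rfl h2, Finset.sum_const, hT.card_children_of_lt (by omega),
      show h + 1 - T.dist z r = n + 1 + 1 by omega]
    have : (h : ℝ) - T.dist z r = n + 1 := by
      rw [← hn]; push_cast; ring
    rw [this]
    simp only [SimpleGraph.dist_self, nsmul_eq_mul, pow_succ (M : ℝ) (n + 1)]
    field_simp
    push_cast
    ring

omit hT in
lemma armSum_add (s : ℕ → ℝ) (e m : ℕ) : armSum s 0 (e + m) = armSum s 0 e + armSum s e m := by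
  simp [armSum, Finset.sum_range_add]

omit [DecidableEq V] in
lemma IsPerfectMAryTree.exists_parent {z : V} (hz : z ≠ r) :
    ∃ p, T.Adj p z ∧ T.dist z r = T.dist p r + 1 := by
  obtain ⟨p, hzp, hp⟩ := exists_adj_dist_add_one hT.isTree.connected hz
  exact ⟨p, hzp.symm, hp.symm⟩

lemma IsPerfectMAryTree.sum_dist_eq (hM : 2 ≤ M) (z : V) :
    ∑ u, (T.dist u z : ℝ) = ∑ u, (T.dist u r : ℝ) +
      (subtreeSize M h 0 * T.dist z r - 2 * armSum (subtreeSize M h) 0 (T.dist z r)) := by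
  obtain ⟨n, hn⟩ : ∃ n, T.dist z r = n := ⟨_, rfl⟩
  induction n generalizing z with
  | zero =>
    obtain rfl := hT.isTree.connected.dist_eq_zero_iff.1 hn
    simp [armSum]
  | succ n ih =>
    obtain ⟨p, hpz, hp⟩ := hT.exists_parent (z := z) (by rintro rfl; simp at hn)
    rw [sum_dist_eq_parent hT.isTree hpz hp, hT.card_subtree hM, ih p (by omega), hn,
      show T.dist p r = n by omega, armSum_add _ n 1, armSum_one, hT.card_eq hM]
    push_cast
    ring

/-- The positions of two nodes relative to their deepest common ancestor (at level `e`), and the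
sum of the squared differences of the distances to them. -/
lemma IsPerfectMAryTree.exists_common_ancestor_level (hM : 2 ≤ M) (x y : V) :
    ∃ e a b : ℕ, T.dist x r = e + a ∧ T.dist y r = e + b ∧ T.dist x y = a + b ∧
      ∑ u, ((T.dist u x : ℝ) - T.dist u y) ^ 2 =
        subtreeSize M h 0 * ((a : ℝ) - b) ^ 2 +
        4 * (armMoment (subtreeSize M h) e a + (b - a) * armSum (subtreeSize M h) e a +
          armMoment (subtreeSize M h) e b + (a - b) * armSum (subtreeSize M h) e b) := by
  obtain ⟨n, hn⟩ : ∃ n, T.dist x r + T.dist y r = n := ⟨_, rfl⟩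
  induction n using Nat.strong_induction_on generalizing x y with
  | _ n ih =>
    wlog hle : T.dist x r ≤ T.dist y r generalizing x y
    · obtain ⟨e, a, b, h1, h2, h3, h4⟩ := this y x (by omega) (by omega)
      refine ⟨e, b, a, h2, h1, by rw [T.dist_comm, h3, add_comm], ?_⟩
      rw [Finset.sum_congr rfl fun u _ => sub_sq_comm _ _, h4]
      ring
    by_cases hxy : x = y
    · subst hxy
      exact ⟨T.dist x r, 0, 0, by simp, by simp, by simp, by simp [armSum, armMoment]⟩
    have hpos := hT.isTree.connected.pos_dist_of_ne hxy
    -- `y` is at least as deep as `x` and distinct from it. Replacing `y` by its parent therefore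
    -- shortens that arm and leaves `e` and `a` unchanged.
    have hx : x ∉ subtree T r y := by
      rw [mem_subtree]; omega
    have hyr : y ≠ r := by
      rintro rfl
      rw [SimpleGraph.dist_self] at hle
      omega
    obtain ⟨p, hpy, hp⟩ := hT.exists_parent hyr
    obtain ⟨e, a, b, h1, h2, h3, h4⟩ := ih _ (by omega) x p rfl
    have hd := dist_of_notMem hT.isTree hpy hp hx
    refine ⟨e, a, b + 1, h1, by omega, by omega, ?_⟩
    rw [sum_sq_dist_sub_eq_parent hT.isTree hpy hp hx, h4, hT.card_subtree hM, hT.card_eq hM,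
      hT.sum_dist_eq hM x, hT.sum_dist_eq hM p, hd, h3, hp, h1, h2, armSum_add, armSum_add]
    simp only [armSum, armMoment, Finset.sum_range_succ]
    push_cast
    ring

lemma IsPerfectMAryTree.coherence_singleton (x : V) :
    coherence T {x} = (1 / 2) * ∑ u, (T.dist u x : ℝ) := by
  rw [coherence, trace_inv_singleton hT.isTree]

lemma IsPerfectMAryTree.coherence_pair (hM : 2 ≤ M) {x y : V} (hxy : x ≠ y) :
    ∃ e a b : ℕ, T.dist x r = e + a ∧ T.dist y r = e + b ∧ T.dist x y = a + b ∧
      coherence T {x, y} = (1 / 2) * (∑ u, (T.dist u r : ℝ) +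
        pairExcess (subtreeSize M h) e a b / (a + b)) := by
  obtain ⟨e, a, b, h1, h2, h3, h4⟩ := hT.exists_common_ancestor_level hM x y
  refine ⟨e, a, b, h1, h2, h3, ?_⟩
  have hd : (a : ℝ) + b ≠ 0 := by
    have := hT.isTree.connected.pos_dist_of_ne hxy
    rw [h3] at this
    exact_mod_cast this.ne'
  rw [coherence, trace_inv_pair hT.isTree hxy, h4, hT.sum_dist_eq hM x, hT.sum_dist_eq hM y,
    hT.card_eq hM, h1, h2, h3, armSum_add, armSum_add, pairExcess]
  push_cast
  field_simp
  ring

end Perfect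

/-! ### Comparison of all leader sets and the optimal value. -/

section Optimal

variable {V : Type*} [Fintype V] [DecidableEq V] {T : SimpleGraph V} [DecidableRel T.Adj] {r : V}
  {M h : ℕ}

lemma IsPerfectMAryTree.coherence_root_child (hT : IsPerfectMAryTree T r M h) (hM : 4 ≤ M)
    {x y : V} (hxy : T.dist x y = 1) (hx : T.dist x r = 0) :
    coherence T {x, y} = (1 / 2) * (∑ u, (T.dist u r : ℝ) - subtreeSize M h 1) := by
  have hne : x ≠ y := by rintro rfl; simp at hxy
  obtain ⟨e, a, b, h1, h2, h3, h4⟩ := hT.coherence_pair (by omega) hne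
  obtain rfl : e = 0 := by omega
  have hab : a + b = 1 := by omega
  have hab' : (a : ℝ) + b = 1 := by exact_mod_cast hab
  rw [h4, pairExcess_root_child hab, hab']
  ring

lemma IsPerfectMAryTree.coherence_gt (hT : IsPerfectMAryTree T r M h) (hM : 4 ≤ M) (hh : 1 ≤ h)
    {S : Finset V} (hS : S.Nonempty) (hS2 : S.card ≤ 2)
    (hne : ¬ ∃ x y : V, S = {x, y} ∧ T.dist x y = 1 ∧ T.dist x r = 0) :
    (1 / 2) * (∑ u, (T.dist u r : ℝ) - subtreeSize M h 1) < coherence T S := by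
  have h4M : (4 : ℝ) ≤ M := by exact_mod_cast hM
  have hs0 := subtreeSize_nonneg (M := M) (h := h) (by omega)
  have hs := four_mul_subtreeSize_le (h := h) hM
  have hs1 : 0 < subtreeSize M h 1 := by
    rw [subtreeSize_succ (by omega) hh]
    have := mul_nonneg (show (0 : ℝ) ≤ M by positivity) (hs0 (1 + 1))
    linarith
  have hroot : 4 * subtreeSize M h 1 < subtreeSize M h 0 := by
    rw [subtreeSize_succ (k := 0) (by omega) (by omega)]
    have := mul_le_mul_of_nonneg_right h4M (hs0 1)
    simp only [zero_add]
    linarith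
  have hcard : S.card = 1 ∨ S.card = 2 := by
    have := hS.card_pos
    omega
  rcases hcard with hc | hc
  · obtain ⟨x, rfl⟩ := Finset.card_eq_one.1 hc
    -- A single leader never beats the root alone, which already loses by `s 1 / 2`.
    rw [hT.coherence_singleton, hT.sum_dist_eq (by omega) x]
    have h1 := armSum_zero_le hs0 hs (T.dist x r)
    have h2 : (T.dist x r : ℝ) * (4 * subtreeSize M h 1) ≤ T.dist x r * subtreeSize M h 0 :=
      mul_le_mul_of_nonneg_left hroot.le (by positivity)
    have h3 : 0 ≤ (T.dist x r : ℝ) * subtreeSize M h 1 := mul_nonneg (by positivity) (hs0 1)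
    linarith
  · obtain ⟨x, y, hxy, rfl⟩ := Finset.card_eq_two.1 hc
    obtain ⟨e, a, b, h1, h2, h3, h4⟩ := hT.coherence_pair (by omega) hxy
    have hpos : 0 < a + b := h3 ▸ hT.isTree.connected.pos_dist_of_ne hxy
    have hpos' : (0 : ℝ) < a + b := by exact_mod_cast hpos
    have hex := pairExcess_gt hs0 hs hs1 hroot hpos (e := e) (by
      rintro ⟨rfl, hab⟩
      apply hne
      rcases Nat.eq_zero_or_pos a with rfl | ha
      · exact ⟨x, y, rfl, by omega, by omega⟩
      · exact ⟨y, x, Finset.pair_comm _ _, by rw [T.dist_comm]; omega, by omega⟩)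
    have : -subtreeSize M h 1 < pairExcess (subtreeSize M h) e a b / (a + b) := by
      rw [lt_div_iff₀ hpos']
      linarith
    rw [h4]
    linarith

lemma IsPerfectMAryTree.isOptimalLeaderSet_iff (hT : IsPerfectMAryTree T r M h) (hM : 4 ≤ M)
    (hh : 1 ≤ h) (S : Finset V) :
    IsOptimalLeaderSet T 2 S ↔ ∃ x y : V, S = {x, y} ∧ T.dist x y = 1 ∧ T.dist x r = 0 := by
  constructor
  · rintro ⟨⟨hS, hS2⟩, hmin⟩
    by_contra hne
    obtain ⟨c, hc⟩ : (children T r r).Nonempty := by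
      rw [← Finset.card_pos, hT.card_children_of_lt (by simp; omega)]
      omega
    have hrc : T.dist r c = 1 := SimpleGraph.dist_eq_one_iff_adj.2 (mem_children.1 hc).1
    have h1 := hmin {r, c} (by simp) Finset.card_le_two
    rw [hT.coherence_root_child hM hrc (by simp)] at h1
    exact absurd (hT.coherence_gt hM hh hS hS2 hne) h1.not_gt
  · rintro ⟨x, y, rfl, hxy, hx⟩
    refine ⟨⟨by simp, Finset.card_le_two⟩, fun S' hS' hS2' => ?_⟩
    rw [hT.coherence_root_child hM hxy hx]
    by_cases hne : ∃ x y : V, S' = {x, y} ∧ T.dist x y = 1 ∧ T.dist x r = 0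
    · obtain ⟨x', y', rfl, hxy', hx'⟩ := hne
      rw [hT.coherence_root_child hM hxy' hx']
    · exact (hT.coherence_gt hM hh hS' hS2' hne).le

lemma IsPerfectMAryTree.optimal_value_eq (hT : IsPerfectMAryTree T r M h) (hM : 2 ≤ M) :
    (1 / 2) * (∑ u, (T.dist u r : ℝ) - subtreeSize M h 1) =
        (1 / 2) * ((Fintype.card V : ℝ) + 1 / ((M : ℝ) - 1)) *
            Real.logb M ((Fintype.card V : ℝ) * M - Fintype.card V + 1)
          - (Fintype.card V : ℝ) * ((M : ℝ) ^ 2 + M - 1) / (2 * M * ((M : ℝ) - 1))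
          + 1 / (2 * M) := by
  have h2 : (2 : ℝ) ≤ M := by exact_mod_cast hM
  have hM0 : (M : ℝ) ≠ 0 := by linarith
  have hM1 : (M : ℝ) - 1 ≠ 0 := by linarith
  -- This identity turns the logarithm into `h + 1`.
  have hcard : (Fintype.card V : ℝ) * M - Fintype.card V + 1 = (M : ℝ) ^ (h + 1) := by
    rw [hT.card_eq hM, subtreeSize, Nat.sub_zero]
    field_simp
    ring
  have hlog : Real.logb M ((M : ℝ) ^ (h + 1)) = h + 1 := by
    rw [Real.logb_pow, Real.logb_self_eq_one (by linarith)]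
    push_cast; ring
  have hsum := hT.sum_dist_subtree hM r
  rw [subtree_root, SimpleGraph.dist_self, Nat.sub_zero] at hsum
  rw [hcard, hlog, hsum, hT.card_eq hM, subtreeSize, subtreeSize, Nat.sub_zero,
    Nat.add_sub_cancel, pow_succ]
  field_simp
  push_cast
  ring

end Optimal

end LeaderFollower

theorem mainTheorem8 {V : Type*} [Fintype V] [DecidableEq V] (T : SimpleGraph V)
    [DecidableRel T.Adj] (r : V) (M h : ℕ) (hM : 4 ≤ M) (hh : 4 ≤ h)
    (hT : LeaderFollower.IsPerfectMAryTree T r M h) :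
    (∀ S : Finset V, S.Nonempty → ∀ x₀ : {v // v ∉ S} → ℝ,
      Tendsto (LeaderFollower.totalVariance T S x₀) atTop
        (𝓝 (LeaderFollower.coherence T S))) ∧
    (∀ S : Finset V, LeaderFollower.IsOptimalLeaderSet T 2 S ↔
      ∃ x y : V, S = {x, y} ∧ T.dist x y = 1 ∧ T.dist x r = 0) ∧
    (∀ S : Finset V, LeaderFollower.IsOptimalLeaderSet T 2 S →
      LeaderFollower.coherence T S =
        (1 / 2) * ((Fintype.card V : ℝ) + 1 / ((M : ℝ) - 1)) *
            Real.logb M ((Fintype.card V : ℝ) * M - Fintype.card V + 1)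
          - (Fintype.card V : ℝ) * ((M : ℝ) ^ 2 + M - 1) / (2 * M * ((M : ℝ) - 1))
          + 1 / (2 * M)) := by
  refine ⟨fun S hS x₀ => LeaderFollower.tendsto_totalVariance T hT.isTree.connected hS x₀,
    hT.isOptimalLeaderSet_iff hM (by omega), fun S hS => ?_⟩
  obtain ⟨x, y, rfl, hxy, hx⟩ := (hT.isOptimalLeaderSet_iff hM (by omega) S).1 hS
  rw [hT.coherence_root_child hM hxy hx, hT.optimal_value_eq (by omega)]
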